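/- Let $d\ge 0$ and let $c:\mathbb{R}^d\times\mathbb{R}^d\to\mathbb{R}$ satisfy: (i) $c$ is continuous and bounded below; (ii) for every $y$, the function $x\mapsto c(x,y)$ is differentiable on $\mathbb{R}^d$; (iii) for every compact $K\subset\mathbb{R}^d$ and every $x_0\in\mathbb{R}^d$ there are a neighbourhood $U$ of $x_0$ and a constant $L$ such that $x\mapsto c(x,y)$ is $L$-Lipschitz on $U$ for all $y\in K$. Let $\rho$ and $\mu$ be Borel probability measures on $\mathbb{R}^d$, and let $\mathcal{X},\mathcal{Y}\subset\mathbb{R}^d$ be sets carrying them, i.e. $\rho(\mathbb{R}^d\setminus\mathcal{X})=0$ and $\mu(\mathbb{R}^d\setminus\mathcal{Y})=0$ (for example $\mathcal{X}=\mathcal{Y}=\mathbb{R}^d$). The Kantorovich dual problem is $$\max_{(\phi,\psi)}\ \int_{\mathcal{X}}\phi\,\mathrm{d}\rho+\int_{\mathcal{Y}}\psi\,\mathrm{d}\mu ,$$ over all real-valued $\phi\in L^1(\mathcal{X},\rho)$ and $\psi\in L^1(\mathcal{Y},\mu)$ with $\phi(x)+\psi(y)\le c(x,y)$ for all $(x,y)\in\mathcal{X}\times\mathcal{Y}$;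 an optimiser is an admissible pair attaining the maximum. Call $\Omega\subset\mathbb{R}^d$ Lipschitz-path connected if any $x_0,x_1\in\Omega$ are joined by a continuous curve $\omega:[0,1]\to\Omega$ of finite length with $\omega(0)=x_0$ and $\omega(1)=x_1$. Assume that $\operatorname{supp}\rho$ is Lipschitz-path connected and that $\operatorname{supp}\mu$ is bounded. Then optimisers of the dual problem are unique up to an additive constant: if $(\phi_0,\psi_0)$ and $(\phi_1,\psi_1)$ are two optimisers, there is $a\in\mathbb{R}$ such that $\phi_1=\phi_0+a$ $\rho$-almost everywhere and $\psi_1=\psi_0-a$ $\mu$-almost everywhere. -/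

import Mathlib

open MeasureTheory Set Topology
open scoped NNReal ENNReal

/-- The standing hypotheses on a cost `c : ℝᵈ × ℝᵈ → ℝ`: it is continuous, bounded below,
differentiable in the first variable, and locally Lipschitz in the first variable, with a constant
that is uniform over compact sets of the second variable. -/
structure IsRegularCost {d : ℕ}
    (c : EuclideanSpace ℝ (Fin d) → EuclideanSpace ℝ (Fin d) → ℝ) : Prop where
  continuous : Continuous (fun p : EuclideanSpace ℝ (Fin d) × EuclideanSpace ℝ (Fin d) => c p.1 p.2)
  bounded_below : ∃ m : ℝ, ∀ x y, m ≤ c x y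
  differentiable : ∀ y, Differentiable ℝ (fun x => c x y)
  equi_locally_lipschitz : ∀ K : Set (EuclideanSpace ℝ (Fin d)), IsCompact K →
    ∀ x₀, ∃ U ∈ 𝓝 x₀, ∃ L : ℝ≥0, ∀ y ∈ K, LipschitzOnWith L (fun x => c x y) U

/-- `Ω` is Lipschitz-path connected: any two of its points are joined, inside `Ω`, by a continuous
curve `ω : [0, 1] → Ω` of finite length (the length of a curve is its total variation). -/
def IsLipschitzPathConnected {d : ℕ} (Ω : Set (EuclideanSpace ℝ (Fin d))) : Prop :=
  ∀ x₀ ∈ Ω, ∀ x₁ ∈ Ω, ∃ ω : ℝ → EuclideanSpace ℝ (Fin d),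
    ContinuousOn ω (Icc 0 1) ∧ eVariationOn ω (Icc 0 1) ≠ ∞ ∧ MapsTo ω (Icc 0 1) Ω ∧
      ω 0 = x₀ ∧ ω 1 = x₁

/-- Admissible pairs of the Kantorovich dual problem between `ρ`, carried by `X`, and `μ`, carried
by `Y`: integrable potentials `φ`, `ψ` with `φ x + ψ y ≤ c x y` for all `x ∈ X` and `y ∈ Y`. The
values of `φ` off `X` and of `ψ` off `Y` play no role. -/
structure IsDualAdmissible {d : ℕ}
    (c : EuclideanSpace ℝ (Fin d) → EuclideanSpace ℝ (Fin d) → ℝ)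
    (X Y : Set (EuclideanSpace ℝ (Fin d))) (ρ μ : Measure (EuclideanSpace ℝ (Fin d)))
    (φ ψ : EuclideanSpace ℝ (Fin d) → ℝ) : Prop where
  integrable_left : Integrable φ ρ
  integrable_right : Integrable ψ μ
  le_cost : ∀ x ∈ X, ∀ y ∈ Y, φ x + ψ y ≤ c x y

/-- Optimisers of the Kantorovich dual problem: admissible pairs that maximise
`∫ φ dρ + ∫ ψ dμ` among all admissible pairs. -/
def IsDualOptimal {d : ℕ}
    (c : EuclideanSpace ℝ (Fin d) → EuclideanSpace ℝ (Fin d) → ℝ)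
    (X Y : Set (EuclideanSpace ℝ (Fin d))) (ρ μ : Measure (EuclideanSpace ℝ (Fin d)))
    (φ ψ : EuclideanSpace ℝ (Fin d) → ℝ) : Prop :=
  IsDualAdmissible c X Y ρ μ φ ψ ∧
    ∀ φ' ψ' : EuclideanSpace ℝ (Fin d) → ℝ, IsDualAdmissible c X Y ρ μ φ' ψ' →
      (∫ x, φ' x ∂ρ) + ∫ y, ψ' y ∂μ ≤ (∫ x, φ x ∂ρ) + ∫ y, ψ y ∂μ

/-! Optimality forces `φ` to agree `ρ`-a.e. with the `c`-transform of `ψ` over `S = Y ∩ μ.support`,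
which is locally Lipschitz (`IsDualOptimal.ae_eq_cTransform`). The average of two optimisers is
again optimal, so on `ρ.support` the transform of the average is the average of the transforms.
Near-minimisers for the average are then near-minimisers for both potentials, and a cluster point
`y` makes `c · y`, up to constants, touch both transforms from above at the same point
(`exists_common_superdifferential`). Hence both have the same derivative almost everywhere along a
rectifiable curve in `ρ.support`, and their difference is constant
(`sub_eq_sub_of_common_superdifferential`). The first potential then determines the second. -/

/-! ### Rectifiable curves and derivatives along them -/

theorem ContinuousOn.variationOnFromTo {E : Type*} [PseudoMetricSpace E] {f : ℝ → E} {s : Set ℝ}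
    {a : ℝ} (hf : ContinuousOn f s) (hbv : LocallyBoundedVariationOn f s) (ha : a ∈ s) :
    ContinuousOn (variationOnFromTo f s a) s := by
  intro b hb
  have hl := variationOnFromTo.tendsto_left ha hb hbv ((hf b hb).mono_left
    (nhdsWithin_mono _ inter_subset_left))
  have hr := variationOnFromTo.tendsto_right ha hb hbv ((hf b hb).mono_left
    (nhdsWithin_mono _ inter_subset_left))
  -- The variation jumps exactly as much as `f` does, here by zero.
  rw [dist_self, sub_zero] at hl
  rw [dist_self, add_zero] at hr
  have hs : s ⊆ insert b (s ∩ Iio b ∪ s ∩ Ioi b) := by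
    intro x hx
    rcases lt_trichotomy x b with h | h | h
    · exact Or.inr (Or.inl ⟨hx, h⟩)
    · exact Or.inl h
    · exact Or.inr (Or.inr ⟨hx, h⟩)
  refine ContinuousWithinAt.mono ?_ hs
  rw [continuousWithinAt_insert_self]
  exact ContinuousWithinAt.union hl hr

/-- A continuous curve of bounded variation has a `1`-Lipschitz reparametrisation. -/
theorem exists_lipschitzOnWith_one_reparametrization {E : Type*} [MetricSpace E] {ω : ℝ → E}
    {a b : ℝ} (hab : a ≤ b) (hω : ContinuousOn ω (Icc a b)) (hbv : BoundedVariationOn ω (Icc a b)) :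
    ∃ (ℓ : ℝ) (γ : ℝ → E), 0 ≤ ℓ ∧ LipschitzOnWith 1 γ (Icc 0 ℓ) ∧
      MapsTo γ (Icc 0 ℓ) (ω '' Icc a b) ∧ γ 0 = ω a ∧ γ ℓ = ω b := by
  have ha : a ∈ Icc a b := left_mem_Icc.2 hab
  have hb : b ∈ Icc a b := right_mem_Icc.2 hab
  have hlbv := hbv.locallyBoundedVariationOn
  set V := variationOnFromTo ω (Icc a b) a
  set γ := naturalParameterization ω (Icc a b) a
  have hγV : ∀ t ∈ Icc a b, γ (V t) = ω t := fun t ht =>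
    edist_eq_zero.1 (edist_naturalParameterization_eq_zero hlbv ha ht)
  have hVa : V a = 0 := variationOnFromTo.self _ _ _
  -- Continuity of `V` leaves no gap in the arclength parameter, so `γ` takes values on the curve
  -- throughout `[0, V b]`.
  have hsub : Icc 0 (V b) ⊆ V '' Icc a b := by
    rw [← hVa]
    exact intermediate_value_Icc hab (hω.variationOnFromTo hlbv ha)
  refine ⟨V b, γ, variationOnFromTo.nonneg_of_le _ _ hab, ?_, ?_, ?_, hγV b hb⟩
  · have hspeed := has_unit_speed_naturalParameterization ω hlbv ha
    have key : ∀ x ∈ Icc 0 (V b), ∀ y ∈ Icc 0 (V b), x ≤ y →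
        edist (γ x) (γ y) ≤ edist x y := by
      intro x hx y hy hxy
      have h := hspeed (hsub hx) (hsub hy)
      rw [NNReal.coe_one, one_mul] at h
      rw [edist_comm x y, edist_dist y x, Real.dist_eq, abs_of_nonneg (sub_nonneg.2 hxy), ← h]
      exact eVariationOn.edist_le _ ⟨hsub hx, left_mem_Icc.2 hxy⟩ ⟨hsub hy, right_mem_Icc.2 hxy⟩
    intro x hx y hy
    rw [ENNReal.coe_one, one_mul]
    rcases le_total x y with h | h
    · exact key x hx y hy h
    · rw [edist_comm, edist_comm x]
      exact key y hy x hx h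
  · intro s hs
    obtain ⟨t, ht, rfl⟩ := hsub hs
    exact ⟨t, ht, (hγV t ht).symm⟩
  · rw [← hVa]
    exact hγV a ha

theorem LocallyLipschitz.exists_lipschitzOnWith_comp {E : Type*} [MetricSpace E] {u : E → ℝ}
    (hu : LocallyLipschitz u) {γ : ℝ → E} {K : ℝ≥0} {s : Set ℝ} (hs : IsCompact s)
    (hγ : LipschitzOnWith K γ s) : ∃ C, LipschitzOnWith C (u ∘ γ) s := by
  obtain ⟨C, hC⟩ := (hu.locallyLipschitzOn (s := γ '' s)).exists_lipschitzOnWith_of_compact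
    (hs.image_of_continuousOn hγ.continuousOn)
  exact ⟨C * K, hC.comp hγ (mapsTo_image γ s)⟩

/-- A function touched from above at `γ t` by a function `k` differentiable there has, along `γ`,
the derivative that `k` has. -/
theorem HasDerivAt.comp_eq_of_le_sub {E : Type*} [NormedAddCommGroup E] [NormedSpace ℝ E]
    {u k : E → ℝ} {γ : ℝ → E} {t g : ℝ} {γ' : E} (hu : HasDerivAt (u ∘ γ) g t)
    (hγ : HasDerivAt γ γ' t) (hk : DifferentiableAt ℝ k (γ t))
    (h : ∀ z, u z - u (γ t) ≤ k z - k (γ t)) : g = fderiv ℝ k (γ t) γ' := by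
  have hkγ : HasDerivAt (k ∘ γ) (fderiv ℝ k (γ t) γ') t := hk.hasFDerivAt.comp_hasDerivAt t hγ
  have hmin : IsLocalMin (k ∘ γ - u ∘ γ) t := Filter.Eventually.of_forall fun s => by
    have := h (γ s)
    simp only [Pi.sub_apply, Function.comp_apply]
    linarith
  have := hmin.hasDerivAt_eq_zero (hkγ.sub hu)
  linarith

/-- Two locally Lipschitz functions that are touched from above, at each point of a Lipschitz
curve, by a common differentiable function differ by a constant along the curve. -/
theorem sub_eq_sub_of_common_superdifferential {E : Type*} [NormedAddCommGroup E] [NormedSpace ℝ E]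
    [FiniteDimensional ℝ E] {u v : E → ℝ} (hu : LocallyLipschitz u) (hv : LocallyLipschitz v)
    {γ : ℝ → E} {K : ℝ≥0} {ℓ : ℝ} (hℓ : 0 ≤ ℓ) (hγ : LipschitzOnWith K γ (Icc 0 ℓ))
    (h : ∀ t ∈ Icc 0 ℓ, ∃ k : E → ℝ, DifferentiableAt ℝ k (γ t) ∧
      ∀ z, u z - u (γ t) ≤ k z - k (γ t) ∧ v z - v (γ t) ≤ k z - k (γ t)) :
    u (γ ℓ) - v (γ ℓ) = u (γ 0) - v (γ 0) := by
  rw [← uIcc_of_le hℓ] at hγ h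
  obtain ⟨C, hC⟩ := hu.exists_lipschitzOnWith_comp isCompact_uIcc hγ
  obtain ⟨D, hD⟩ := hv.exists_lipschitzOnWith_comp isCompact_uIcc hγ
  have hac := hC.absolutelyContinuousOnInterval.sub hD.absolutelyContinuousOnInterval
  have hγbv := hγ.absolutelyContinuousOnInterval.boundedVariationOn
  -- Only the compositions with `γ` are differentiated: the curve may be Lebesgue-null in `E`, so
  -- differentiability of `u` and `v` a.e. in `E` would say nothing on it.
  obtain ⟨a, ha⟩ := hac.const_of_ae_hasDerivAt_zero (by
    filter_upwards [hγbv.ae_differentiableAt_of_mem_uIcc,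
      hC.absolutelyContinuousOnInterval.ae_differentiableAt,
      hD.absolutelyContinuousOnInterval.ae_differentiableAt] with t h1 h2 h3 ht
    obtain ⟨k, hk, hle⟩ := h t ht
    have e2 := (h2 ht).hasDerivAt.comp_eq_of_le_sub (h1 ht).hasDerivAt hk fun z => (hle z).1
    have e3 := (h3 ht).hasDerivAt.comp_eq_of_le_sub (h1 ht).hasDerivAt hk fun z => (hle z).2
    have := (h2 ht).hasDerivAt.sub (h3 ht).hasDerivAt
    rwa [e2, e3, sub_self] at this)
  have h0 := ha 0 left_mem_uIcc
  have h1 := ha ℓ right_mem_uIcc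
  simp only [Pi.sub_apply, Function.comp_apply] at h0 h1
  rw [h0, h1]

/-! ### `c`-transforms -/

/-- The `c`-transform `x ↦ inf_{y ∈ S} (c x y - ψ y)`. -/
noncomputable def cTransform {α β : Type*} (c : α → β → ℝ) (S : Set β) (ψ : β → ℝ) (x : α) : ℝ :=
  ⨅ y : S, (c x y - ψ y)

section CTransform

variable {α β : Type*} {c : α → β → ℝ} {S : Set β} {ψ : β → ℝ} {m M : ℝ}

theorem cTransform_le (hm : ∀ x y, m ≤ c x y) (hM : ∀ y ∈ S, ψ y ≤ M) (x : α) {y : β}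
    (hy : y ∈ S) : cTransform c S ψ x ≤ c x y - ψ y := by
  refine ciInf_le (f := fun y : S => c x y - ψ y) ⟨m - M, ?_⟩ ⟨y, hy⟩
  rintro _ ⟨z, rfl⟩
  have h1 := hm x z
  have h2 := hM z z.2
  simp only
  linarith

theorem le_cTransform (hS : S.Nonempty) {x : α} {a : ℝ} (h : ∀ y ∈ S, a ≤ c x y - ψ y) :
    a ≤ cTransform c S ψ x := by
  have := hS.to_subtype
  exact le_ciInf fun y => h y y.2

theorem exists_lt_of_cTransform_lt (hS : S.Nonempty) {x : α} {a : ℝ} (h : cTransform c S ψ x < a) :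
    ∃ y ∈ S, c x y - ψ y < a := by
  by_contra! hc
  exact absurd (le_cTransform hS hc) (not_le.2 h)

/-- An infimum of functions sharing a local Lipschitz constant inherits that constant. -/
theorem locallyLipschitz_cTransform [PseudoMetricSpace α] (hS : S.Nonempty)
    (hm : ∀ x y, m ≤ c x y) (hM : ∀ y ∈ S, ψ y ≤ M)
    (hc : ∀ x₀, ∃ U ∈ 𝓝 x₀, ∃ L : ℝ≥0, ∀ y ∈ S, LipschitzOnWith L (fun x => c x y) U) :
    LocallyLipschitz (cTransform c S ψ) := by
  intro x₀
  obtain ⟨U, hU, L, hL⟩ := hc x₀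
  refine ⟨L, U, hU, LipschitzOnWith.of_le_add_mul _ fun x hx x' hx' => ?_⟩
  rw [← sub_le_iff_le_add]
  refine le_cTransform hS fun y hy => ?_
  have h1 := cTransform_le hm hM x hy
  have h2 := (hL y hy).le_add_mul hx hx'
  linarith

/-- If the `c`-transform is affine between `ψ₀` and `ψ₁` at `x`, then both transforms are
`c`-superdifferentiable at `x` with a common `c`-supergradient. -/
theorem exists_common_superdifferential [TopologicalSpace β] [FirstCountableTopology β]
    {K : Set β} {ψ₀ ψ₁ : β → ℝ} {M₀ M₁ : ℝ}
    (hS : S.Nonempty) (hK : IsCompact K) (hSK : S ⊆ K) (hc : ∀ x, Continuous (c x))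
    (hm : ∀ x y, m ≤ c x y) (h₀ : ∀ y ∈ S, ψ₀ y ≤ M₀) (h₁ : ∀ y ∈ S, ψ₁ y ≤ M₁) {x : α}
    (hx : cTransform c S (fun y => (ψ₀ y + ψ₁ y) / 2) x =
      (cTransform c S ψ₀ x + cTransform c S ψ₁ x) / 2) :
    ∃ y, ∀ z, cTransform c S ψ₀ z - cTransform c S ψ₀ x ≤ c z y - c x y ∧
      cTransform c S ψ₁ z - cTransform c S ψ₁ x ≤ c z y - c x y := by
  -- The infimum need not be attained, as `ψ₀` and `ψ₁` have no regularity. An excess `ε` for the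
  -- average is half the sum of two nonnegative excesses, so each is at most `2 * ε`. The limit `y'`
  -- may leave `S`: only `c` is evaluated there.
  have hy : ∀ n : ℕ, ∃ y ∈ S, c x y - (ψ₀ y + ψ₁ y) / 2 <
      cTransform c S (fun y => (ψ₀ y + ψ₁ y) / 2) x + 1 / ((n : ℝ) + 1) := fun n =>
    exists_lt_of_cTransform_lt hS (lt_add_of_pos_right _ Nat.one_div_pos_of_nat)
  choose y hyS hy using hy
  obtain ⟨y', -, σ, hσ, hlim⟩ := hK.tendsto_subseq fun n => hSK (hyS n)
  have hε : Filter.Tendsto (fun n => 2 * (1 / ((σ n : ℝ) + 1))) Filter.atTop (𝓝 0) := by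
    have := (tendsto_one_div_add_atTop_nhds_zero_nat (𝕜 := ℝ)).comp hσ.tendsto_atTop
    simpa using this.const_mul 2
  have hlim' : ∀ z, Filter.Tendsto (fun n => c z (y (σ n)) - c x (y (σ n)) +
      2 * (1 / ((σ n : ℝ) + 1))) Filter.atTop (𝓝 (c z y' - c x y')) := fun z => by
    simpa using ((((hc z).tendsto y').comp hlim).sub (((hc x).tendsto y').comp hlim)).add hε
  refine ⟨y', fun z => ⟨ge_of_tendsto' (hlim' z) fun n => ?_, ge_of_tendsto' (hlim' z) fun n => ?_⟩⟩
  all_goals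
    have a0 := cTransform_le hm h₀ z (hyS (σ n))
    have a1 := cTransform_le hm h₁ z (hyS (σ n))
    have b0 := cTransform_le hm h₀ x (hyS (σ n))
    have b1 := cTransform_le hm h₁ x (hyS (σ n))
    have e := hy (σ n)
    rw [hx] at e
    linarith

end CTransform

theorem ae_eq_of_ae_le_of_integral_le {α : Type*} [MeasurableSpace α] {μ : Measure α} {f g : α → ℝ}
    (hf : Integrable f μ) (hg : Integrable g μ) (hfg : f ≤ᵐ[μ] g)
    (h : ∫ x, g x ∂μ ≤ ∫ x, f x ∂μ) : f =ᵐ[μ] g :=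
  (integral_eq_iff_of_ae_le hf hg hfg).1 (le_antisymm (integral_mono_ae hf hg hfg) h)

theorem Continuous.eqOn_support_of_ae_eq {α : Type*} [TopologicalSpace α] [MeasurableSpace α]
    {μ : Measure α} {f g : α → ℝ} (hf : Continuous f) (hg : Continuous g) (h : f =ᵐ[μ] g) :
    EqOn f g μ.support :=
  fun _ hx => Measure.support_subset_of_isClosed (isClosed_eq hf hg) h hx

/-! ### Dual optimisers -/

section Dual

variable {d : ℕ} {c : EuclideanSpace ℝ (Fin d) → EuclideanSpace ℝ (Fin d) → ℝ}
  {X Y : Set (EuclideanSpace ℝ (Fin d))} {ρ μ : Measure (EuclideanSpace ℝ (Fin d))}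
  {φ ψ φ₀ ψ₀ φ₁ ψ₁ : EuclideanSpace ℝ (Fin d) → ℝ}

theorem IsRegularCost.continuous_right (hc : IsRegularCost c) (x : EuclideanSpace ℝ (Fin d)) :
    Continuous (c x) :=
  hc.continuous.comp (Continuous.prodMk_right x)

theorem nonempty_inter_support [IsProbabilityMeasure μ] (hY : μ Yᶜ = 0) :
    (Y ∩ μ.support).Nonempty :=
  Filter.NeBot.nonempty_of_mem inferInstance
    (Filter.inter_mem (mem_ae_iff.2 hY) Measure.support_mem_ae)

theorem isCompact_support_of_isBounded (hμ : Bornology.IsBounded μ.support) :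
    IsCompact μ.support :=
  Metric.isCompact_of_isClosed_isBounded Measure.isClosed_support hμ

/-- Testing the constraint at one `x` suffices. Together with the lower bound on `c`, this makes the
infimum in `cTransform` genuine rather than a default value. -/
theorem IsDualAdmissible.exists_le_of_mem (hc : IsRegularCost c) (hX : X.Nonempty)
    (hμ : Bornology.IsBounded μ.support) (h : IsDualAdmissible c X Y ρ μ φ ψ) :
    ∃ M, ∀ y ∈ Y ∩ μ.support, ψ y ≤ M := by
  obtain ⟨x, hx⟩ := hX
  obtain ⟨B, hB⟩ := (isCompact_support_of_isBounded hμ).bddAbove_image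
    (hc.continuous_right x).continuousOn
  refine ⟨B - φ x, fun y hy => ?_⟩
  have h1 := h.le_cost x hx y hy.1
  have h2 := hB (mem_image_of_mem _ hy.2)
  linarith

theorem IsDualAdmissible.locallyLipschitz_cTransform [IsProbabilityMeasure μ]
    (hc : IsRegularCost c) (hX : X.Nonempty)
    (hY : μ Yᶜ = 0) (hμ : Bornology.IsBounded μ.support) (h : IsDualAdmissible c X Y ρ μ φ ψ) :
    LocallyLipschitz (cTransform c (Y ∩ μ.support) ψ) := by
  obtain ⟨m, hm⟩ := hc.bounded_below
  obtain ⟨M, hM⟩ := h.exists_le_of_mem hc hX hμ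
  refine _root_.locallyLipschitz_cTransform (nonempty_inter_support hY) hm hM fun x₀ => ?_
  obtain ⟨U, hU, L, hL⟩ :=
    hc.equi_locally_lipschitz _ (isCompact_support_of_isBounded hμ) x₀
  exact ⟨U, hU, L, fun y hy => hL y hy.2⟩

/-- The first potential of an optimal pair is almost everywhere the `c`-transform of the second. -/
theorem IsDualOptimal.ae_eq_cTransform [IsProbabilityMeasure ρ] [IsProbabilityMeasure μ]
    (hc : IsRegularCost c) (hX : ρ Xᶜ = 0) (hY : μ Yᶜ = 0)
    (hμ : Bornology.IsBounded μ.support) (h : IsDualOptimal c X Y ρ μ φ ψ) :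
    φ =ᵐ[ρ] cTransform c (Y ∩ μ.support) ψ := by
  classical
  obtain ⟨hadm, hopt⟩ := h
  have hXne : X.Nonempty := (nonempty_inter_support hX).mono inter_subset_left
  obtain ⟨m, hm⟩ := hc.bounded_below
  obtain ⟨M, hM⟩ := hadm.exists_le_of_mem hc hXne hμ
  set T := cTransform c (Y ∩ μ.support) ψ
  have hφT : ∀ x ∈ X, φ x ≤ T x := fun x hx => le_cTransform (nonempty_inter_support hY)
    fun y hy => le_sub_iff_add_le.2 (hadm.le_cost x hx y hy.1)
  have hTcont : Continuous T := (hadm.locallyLipschitz_cTransform hc hXne hY hμ).continuous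
  have hXae : ∀ᵐ x ∂ρ, x ∈ X := mem_ae_iff.2 hX
  -- The cap `φ + 1` gives integrability without knowing that of `T`, yet `φ'` still exceeds `φ`
  -- wherever `T` does. Lowering `ψ` by `1` off the support, a `μ`-null change, pays for the gain
  -- there.
  set φ' : EuclideanSpace ℝ (Fin d) → ℝ := fun x => min (T x) (φ x + 1)
  set ψ' : EuclideanSpace ℝ (Fin d) → ℝ := fun y => if y ∈ μ.support then ψ y else ψ y - 1
  have hle : φ ≤ᵐ[ρ] φ' := by
    filter_upwards [hXae] with x hx
    exact le_min (hφT x hx) (by linarith)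
  have hint : Integrable φ' ρ := by
    have hmeas : AEStronglyMeasurable φ' ρ :=
      hTcont.aestronglyMeasurable.inf (hadm.integrable_left.1.add aestronglyMeasurable_const)
    refine Integrable.mono' (hadm.integrable_left.abs.add (integrable_const 1)) hmeas ?_
    filter_upwards [hle] with x hx
    have h1 : φ' x ≤ φ x + 1 := min_le_right _ _
    rw [Real.norm_eq_abs, abs_le]
    simp only [Pi.add_apply]
    constructor <;> linarith [neg_abs_le (φ x), le_abs_self (φ x)]
  have hψψ' : ψ' =ᵐ[μ] ψ := by
    filter_upwards [Measure.support_mem_ae (μ := μ)] with y hy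
    exact if_pos hy
  have hadm' : IsDualAdmissible c X Y ρ μ φ' ψ' := by
    refine ⟨hint, hadm.integrable_right.congr hψψ'.symm, fun x hx y hy => ?_⟩
    by_cases hys : y ∈ μ.support
    · have h1 : φ' x ≤ T x := min_le_left _ _
      have h2 : T x ≤ c x y - ψ y := cTransform_le hm hM x ⟨hy, hys⟩
      have h3 : ψ' y = ψ y := if_pos hys
      linarith
    · have h1 : φ' x ≤ φ x + 1 := min_le_right _ _
      have h2 := hadm.le_cost x hx y hy
      have h3 : ψ' y = ψ y - 1 := if_neg hys
      linarith
  have hval := hopt φ' ψ' hadm'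
  rw [integral_congr_ae hψψ'] at hval
  have heq := ae_eq_of_ae_le_of_integral_le hadm.integrable_left hint hle (by linarith)
  filter_upwards [heq] with x hx
  rcases min_choice (T x) (φ x + 1) with h1 | h1
  · exact hx.trans h1
  · have : φ x = φ x + 1 := hx.trans h1
    linarith

theorem IsDualOptimal.average (h₀ : IsDualOptimal c X Y ρ μ φ₀ ψ₀)
    (h₁ : IsDualOptimal c X Y ρ μ φ₁ ψ₁) :
    IsDualOptimal c X Y ρ μ (fun x => (φ₀ x + φ₁ x) / 2) (fun y => (ψ₀ y + ψ₁ y) / 2) := by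
  obtain ⟨a₀, o₀⟩ := h₀
  obtain ⟨a₁, o₁⟩ := h₁
  refine ⟨⟨(a₀.integrable_left.add a₁.integrable_left).div_const 2,
    (a₀.integrable_right.add a₁.integrable_right).div_const 2, fun x hx y hy => ?_⟩,
    fun φ' ψ' h' => ?_⟩
  · linarith [a₀.le_cost x hx y hy, a₁.le_cost x hx y hy]
  · rw [integral_div, integral_div, integral_add a₀.integrable_left a₁.integrable_left,
      integral_add a₀.integrable_right a₁.integrable_right]
    linarith [o₀ φ' ψ' h', o₁ φ' ψ' h']

/-- The first potential of a dual optimiser determines the second one. -/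
theorem IsDualOptimal.ae_eq_of_ae_eq_add [IsProbabilityMeasure ρ] [IsProbabilityMeasure μ]
    (h₀ : IsDualOptimal c X Y ρ μ φ₀ ψ₀) (h₁ : IsDualOptimal c X Y ρ μ φ₁ ψ₁) {a : ℝ}
    (h : ∀ᵐ x ∂ρ, φ₁ x = φ₀ x + a) : ∀ᵐ y ∂μ, ψ₁ y = ψ₀ y - a := by
  obtain ⟨a₀, o₀⟩ := h₀
  obtain ⟨a₁, o₁⟩ := h₁
  -- Almost everywhere `φ'` equals both candidates, so optimality bounds the integral of `ψ'` by
  -- those of `ψ₁` and `ψ₀ - a`, although `ψ'` dominates both.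
  set φ' : EuclideanSpace ℝ (Fin d) → ℝ := fun x => min (φ₁ x) (φ₀ x + a)
  set ψ' : EuclideanSpace ℝ (Fin d) → ℝ := fun y => max (ψ₁ y) (ψ₀ y - a)
  have hφ₀ : Integrable (fun x => φ₀ x + a) ρ := a₀.integrable_left.add (integrable_const a)
  have hψ₀ : Integrable (fun y => ψ₀ y - a) μ := a₀.integrable_right.sub (integrable_const a)
  have hψ'int : Integrable ψ' μ := a₁.integrable_right.sup hψ₀
  have hadm : IsDualAdmissible c X Y ρ μ φ' ψ' := by
    refine ⟨a₁.integrable_left.inf hφ₀, hψ'int, fun x hx y hy => ?_⟩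
    have h1 : φ' x ≤ φ₁ x := min_le_left _ _
    have h2 : φ' x ≤ φ₀ x + a := min_le_right _ _
    rw [← le_sub_iff_add_le']
    exact max_le (by linarith [a₁.le_cost x hx y hy]) (by linarith [a₀.le_cost x hx y hy])
  have e₁ : φ' =ᵐ[ρ] φ₁ := by
    filter_upwards [h] with x hx
    exact min_eq_left hx.le
  have e₀ : φ' =ᵐ[ρ] fun x => φ₀ x + a := by
    filter_upwards [h] with x hx
    exact min_eq_right hx.ge
  have v₀ := o₀ φ' ψ' hadm
  have v₁ := o₁ φ' ψ' hadm
  rw [integral_congr_ae e₁] at v₁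
  rw [integral_congr_ae e₀, integral_add a₀.integrable_left (integrable_const a)] at v₀
  have hs : ∫ y, (ψ₀ y - a) ∂μ = ∫ y, ψ₀ y ∂μ - ∫ _, a ∂μ :=
    integral_sub a₀.integrable_right (integrable_const a)
  simp only [integral_const, probReal_univ, one_smul] at v₀ hs
  have f₁ : ψ₁ =ᵐ[μ] ψ' := ae_eq_of_ae_le_of_integral_le a₁.integrable_right hψ'int
    (Filter.Eventually.of_forall fun y => le_max_left _ _) (by linarith)
  have f₀ : (fun y => ψ₀ y - a) =ᵐ[μ] ψ' := ae_eq_of_ae_le_of_integral_le hψ₀ hψ'int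
    (Filter.Eventually.of_forall fun y => le_max_right _ _) (by linarith)
  exact f₁.trans f₀.symm

end Dual

theorem mainTheorem1 (d : ℕ)
    (c : EuclideanSpace ℝ (Fin d) → EuclideanSpace ℝ (Fin d) → ℝ) (hc : IsRegularCost c)
    (ρ μ : Measure (EuclideanSpace ℝ (Fin d))) [IsProbabilityMeasure ρ] [IsProbabilityMeasure μ]
    (X Y : Set (EuclideanSpace ℝ (Fin d))) (hX : ρ Xᶜ = 0) (hY : μ Yᶜ = 0)
    (hρ : IsLipschitzPathConnected ρ.support) (hμ : Bornology.IsBounded μ.support)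
    (φ₀ ψ₀ φ₁ ψ₁ : EuclideanSpace ℝ (Fin d) → ℝ)
    (h₀ : IsDualOptimal c X Y ρ μ φ₀ ψ₀) (h₁ : IsDualOptimal c X Y ρ μ φ₁ ψ₁) :
    ∃ a : ℝ, (∀ᵐ x ∂ρ, φ₁ x = φ₀ x + a) ∧ (∀ᵐ y ∂μ, ψ₁ y = ψ₀ y - a) := by
  suffices h : ∃ a : ℝ, ∀ᵐ x ∂ρ, φ₁ x = φ₀ x + a from
    h.imp fun a ha => ⟨ha, h₀.ae_eq_of_ae_eq_add h₁ ha⟩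
  have h₂ := h₀.average h₁
  have hXne : X.Nonempty := (nonempty_inter_support hX).mono inter_subset_left
  have t₀ := h₀.ae_eq_cTransform hc hX hY hμ
  have t₁ := h₁.ae_eq_cTransform hc hX hY hμ
  have t₂ := h₂.ae_eq_cTransform hc hX hY hμ
  have l₀ := h₀.1.locallyLipschitz_cTransform hc hXne hY hμ
  have l₁ := h₁.1.locallyLipschitz_cTransform hc hXne hY hμ
  have l₂ := h₂.1.locallyLipschitz_cTransform hc hXne hY hμ
  obtain ⟨m, hm⟩ := hc.bounded_below
  obtain ⟨M₀, hM₀⟩ := h₀.1.exists_le_of_mem hc hXne hμ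
  obtain ⟨M₁, hM₁⟩ := h₁.1.exists_le_of_mem hc hXne hμ
  set S := Y ∩ μ.support
  -- Equality is needed at every point of the support, since the connecting curve may be `ρ`-null.
  have hmid : EqOn (cTransform c S fun y => (ψ₀ y + ψ₁ y) / 2)
      (fun x => (cTransform c S ψ₀ x + cTransform c S ψ₁ x) / 2) ρ.support := by
    refine l₂.continuous.eqOn_support_of_ae_eq
      ((l₀.continuous.add l₁.continuous).div_const 2) ?_
    filter_upwards [t₀, t₁, t₂] with x x₀ x₁ x₂
    rw [← x₂, x₀, x₁]
  have hsuper : ∀ x ∈ ρ.support, ∃ y, ∀ z,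
      cTransform c S ψ₁ z - cTransform c S ψ₁ x ≤ c z y - c x y ∧
      cTransform c S ψ₀ z - cTransform c S ψ₀ x ≤ c z y - c x y := fun x hx =>
    (exists_common_superdifferential (nonempty_inter_support hY)
      (isCompact_support_of_isBounded hμ) inter_subset_right hc.continuous_right hm hM₀ hM₁
      (hmid hx)).imp fun y hy z => (hy z).symm
  obtain ⟨x₀, hx₀⟩ : ρ.support.Nonempty := Measure.nonempty_support (IsProbabilityMeasure.ne_zero ρ)
  refine ⟨cTransform c S ψ₁ x₀ - cTransform c S ψ₀ x₀, ?_⟩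
  filter_upwards [t₀, t₁, Measure.support_mem_ae (μ := ρ)] with x e₀ e₁ hx
  obtain ⟨ω, hωc, hωv, hωm, rfl, rfl⟩ := hρ x₀ hx₀ x hx
  obtain ⟨ℓ, γ, hℓ, hγ, hγm, hγ0, hγ1⟩ :=
    exists_lipschitzOnWith_one_reparametrization zero_le_one hωc hωv
  have key := sub_eq_sub_of_common_superdifferential l₁ l₀ hℓ hγ fun t ht => by
    obtain ⟨y, hy⟩ := hsuper (γ t) (hωm.image_subset (hγm ht))
    exact ⟨fun x => c x y, hc.differentiable y _, hy⟩
  rw [hγ0, hγ1] at key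
  rw [e₀, e₁]
  linarith
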